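/- **Theorem 3.** Let $k$ be a commutative domain (for example, a field) with $\operatorname{char} k\neq 2$, let $n$ be an even integer, and let $\mathcal A=\{a_{ij}\mid 1\le i<j\le n\}$ and $\mathcal A'=\{a'_{ij}\mid 1\le i<j\le n\}$ be two sets of scalars in $k$. Put $a_{ij}:=a_{ji}$ and $a'_{ij}:=a'_{ji}$ for $i>j$. Let $V_n(\mathcal A)$ be the $k$-algebra generated by $x_1,\dots,x_n$ subject to the relations $$x_ix_j+x_jx_i=a_{ij}\qquad (1\le i<j\le n),$$ and define $V_n(\mathcal A')$ likewise. Then $V_n(\mathcal A)\cong V_n(\mathcal A')$ as $k$-algebras if and only if there are a permutation $\sigma\in S_n$ and invertible scalars $\lambda_1,\dots,\lambda_n\in k^\times$ (if $k$ is a field: nonzero scalars) such that $$a'_{ij}=\lambda_i\lambda_j\,a_{\sigma(i)\sigma(j)}\qquad\text{for all } i\neq j.$$ -/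

import Mathlib

namespace QuantumWeyl

/-- The symmetric extension `a_{ij} = a_{ji}` of a family of scalars `{a_{ij}}_{i < j}`. Only the
values `a i j` with `i < j` are data; for `i = j` the value is a dummy that is never used. -/
def entry {k : Type*} {n : ℕ} (a : Fin n → Fin n → k) (i j : Fin n) : k :=
  if i < j then a i j else a j i

/-- The defining relations `x_i x_j + x_j x_i = a_{ij}` for `i < j`, on the free algebra. -/
inductive Rel {k : Type*} [CommRing k] {n : ℕ} (a : Fin n → Fin n → k) :
    FreeAlgebra k (Fin n) → FreeAlgebra k (Fin n) → Prop
  | anticomm (i j : Fin n) (hij : i < j) :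
      Rel a (FreeAlgebra.ι k i * FreeAlgebra.ι k j + FreeAlgebra.ι k j * FreeAlgebra.ι k i)
        (algebraMap k (FreeAlgebra k (Fin n)) (a i j))

/-- The modified `(-1)`-quantum Weyl algebra `V_n(𝒜)`: the `k`-algebra generated by
`x_1, …, x_n` subject to the relations `x_i x_j + x_j x_i = a_{ij}` for `i < j`. -/
abbrev V {k : Type*} [CommRing k] {n : ℕ} (a : Fin n → Fin n → k) : Type _ :=
  RingQuot (Rel a)

end QuantumWeyl

/-! Ordered monomials give coordinates on `V a`: operators on polynomials imitate left
multiplication by the generators, and evaluating them at `1` gives an injective `symbol`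
(`orderedEval_symbol`). For any monomial order, leading exponents of symbols add under
multiplication, and leading coefficients multiply up to the sign `(-1) ^ crossing α β`
(`isLead_symbol_mul`).

Let `f` be an isomorphism and `α i` the leading exponent of the image of the `i`-th generator. The
anticommutators of these images are scalars, so the top terms must cancel; since `2 ≠ 0`, this makes
`crossing (α i) (α l) + crossing (α l) (α i)` odd for `i ≠ l`. Modulo 2 this says `P * Ω * Pᵀ = Ω`,
with `P` the matrix of exponents and `Ω` having zeros on the diagonal and ones elsewhere. For even
`n`, `Ω` is invertible, hence so is `P`, and the `α i` are linearly independent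
(`sum_smul_injective`). Leading terms of distinct ordered words in the images therefore cannot
cancel. Each generator of the target is a combination of such words, so its exponent is a sum of `α
i`, and some `α i` equals it (`exists_degree_symbol_eq_single`).

For a degree-compatible order the images are then affine. Coefficients of squares and of linear
terms in the anticommutators leave one scaled generator each (`exists_perm_map_gen`), and comparing
relations gives the formula. Conversely, rescaling and permuting generators respects the relations
and is invertible. -/

namespace QuantumWeyl

open MvPolynomial Finsupp

/-! ### Ordered monomials -/

section Words

variable {k : Type*} [CommRing k] {n : ℕ}

/-- Induction on exponent vectors, multiplying by variables of index at most the smallest one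
that occurs. -/
theorem exponent_induction {P : (Fin n →₀ ℕ) → Prop} (zero : P 0)
    (add : ∀ (j : Fin n) (d : Fin n →₀ ℕ), (∀ l < j, d l = 0) → P d → P (d + single j 1))
    (d : Fin n →₀ ℕ) : P d := by
  induction h : d.degree using Nat.strong_induction_on generalizing d with
  | _ N ih =>
    by_cases hd : d = 0
    · exact hd ▸ zero
    · have hs : d.support.Nonempty := Finsupp.support_nonempty_iff.2 hd
      set j := d.support.min' hs with hj
      have hjs : d j ≠ 0 := Finsupp.mem_support_iff.1 (d.support.min'_mem hs)
      have hle : single j 1 ≤ d := by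
        rw [Finsupp.single_le_iff]; omega
      have hsub : d - single j 1 + single j 1 = d := tsub_add_cancel_of_le hle
      rw [← hsub]
      refine add j _ (fun l hl => ?_) (ih _ ?_ _ rfl)
      · have : l ∉ d.support := fun hmem => absurd (d.support.min'_le l hmem) (not_le.2 hl)
        rw [Finsupp.tsub_apply, Finsupp.notMem_support_iff.1 this, Nat.zero_sub]
      · have := congrArg Finsupp.degree hsub
        rw [map_add, Finsupp.degree_single] at this
        omega

/-- The ordered monomial `u_1^{d_1} ⋯ u_n^{d_n}`. -/
noncomputable def word {B : Type*} [Monoid B] (u : Fin n → B) (d : Fin n →₀ ℕ) : B :=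
  (((Finsupp.toMultiset d).sort (· ≤ ·)).map u).prod

theorem word_zero {B : Type*} [Monoid B] (u : Fin n → B) : word u 0 = 1 := by
  simp [word]

theorem word_add_single {B : Type*} [Monoid B] (u : Fin n → B) {j : Fin n} {d : Fin n →₀ ℕ}
    (h : ∀ l < j, d l = 0) : word u (d + single j 1) = u j * word u d := by
  have h1 : Finsupp.toMultiset (d + single j 1) = j ::ₘ Finsupp.toMultiset d := by
    rw [map_add, Finsupp.toMultiset_single, one_smul, add_comm, Multiset.singleton_add]
  have h2 : ∀ b ∈ Finsupp.toMultiset d, j ≤ b := by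
    intro b hb
    by_contra hlt
    exact (Finsupp.mem_support_iff.1 ((Finsupp.mem_toMultiset d b).1 hb)) (h b (not_le.1 hlt))
  rw [word, h1, Multiset.sort_cons _ _ _ h2]
  simp [word]

theorem map_word {B C F : Type*} [Monoid B] [Monoid C] [FunLike F B C] [MonoidHomClass F B C]
    (f : F) (u : Fin n → B) (d : Fin n →₀ ℕ) : f (word u d) = word (fun i => f (u i)) d := by
  simp [word, map_list_prod, Function.comp_def]

/-- The linear map sending a commutative monomial to the ordered monomial in `u`. -/
noncomputable def orderedEval {B : Type*} [Ring B] [Algebra k B] (u : Fin n → B) :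
    MvPolynomial (Fin n) k →ₗ[k] B :=
  (basisMonomials (Fin n) k).constr k (word u)

theorem orderedEval_monomial {B : Type*} [Ring B] [Algebra k B] (u : Fin n → B)
    (d : Fin n →₀ ℕ) : orderedEval (k := k) u (monomial d 1) = word u d := by
  rw [orderedEval, ← Module.Basis.constr_basis (basisMonomials (Fin n) k) k (word u) d,
    coe_basisMonomials]

theorem map_orderedEval {B C : Type*} [Ring B] [Algebra k B] [Ring C] [Algebra k C]
    (f : B →ₐ[k] C) (u : Fin n → B) (p : MvPolynomial (Fin n) k) :
    f (orderedEval u p) = orderedEval (fun i => f (u i)) p := by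
  have : f.toLinearMap ∘ₗ orderedEval u = orderedEval (fun i => f (u i)) :=
    (basisMonomials (Fin n) k).ext fun d => by
      simp [orderedEval_monomial, map_word]
  exact LinearMap.congr_fun this p

end Words

/-! ### Signs of the skew polynomial ring -/

section Representation

variable {k : Type*} [CommRing k] {n : ℕ}

/-- The exponent of the sign acquired when two ordered monomials are multiplied in the
anticommuting case. -/
def crossing (d e : Fin n →₀ ℕ) : ℕ :=
  ∑ i, ∑ l, if l < i then d i * e l else 0

theorem crossing_add_left (d d' e : Fin n →₀ ℕ) :
    crossing (d + d') e = crossing d e + crossing d' e := by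
  simp only [crossing, ← Finset.sum_add_distrib]
  refine Finset.sum_congr rfl fun i _ => Finset.sum_congr rfl fun l _ => ?_
  split_ifs <;> simp [add_mul]

theorem crossing_add_right (d e e' : Fin n →₀ ℕ) :
    crossing d (e + e') = crossing d e + crossing d e' := by
  simp only [crossing, ← Finset.sum_add_distrib]
  refine Finset.sum_congr rfl fun i _ => Finset.sum_congr rfl fun l _ => ?_
  split_ifs <;> simp [mul_add]

theorem crossing_zero_left (e : Fin n →₀ ℕ) : crossing 0 e = 0 := by
  simp [crossing]

theorem crossing_single_left (i : Fin n) (e : Fin n →₀ ℕ) :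
    crossing (single i 1) e = ∑ l, if l < i then e l else 0 := by
  rw [crossing, Finset.sum_eq_single i]
  · simp
  · intro b _ hb
    simp [Finsupp.single_eq_of_ne hb]
  · simp

theorem crossing_single_single (i l : Fin n) :
    crossing (single i 1) (single l 1) = if l < i then 1 else 0 := by
  rw [crossing_single_left, Finset.sum_eq_single l]
  · simp
  · intro b _ hb
    simp [Finsupp.single_eq_of_ne hb]
  · simp

theorem crossing_single_left_eq_zero {i : Fin n} {e : Fin n →₀ ℕ} (h : ∀ l < i, e l = 0) :
    crossing (single i 1) e = 0 := by
  rw [crossing_single_left]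
  refine Finset.sum_eq_zero fun l _ => ?_
  split_ifs with hl
  · exact h l hl
  · rfl

variable (k) in
/-- The sign acquired by `x_i` when it is moved into its place in the ordered monomial `x^d`. -/
noncomputable def sgn (i : Fin n) (d : Fin n →₀ ℕ) : k := (-1) ^ crossing (single i 1) d

theorem sgn_mul_self (i : Fin n) (d : Fin n →₀ ℕ) : sgn k i d * sgn k i d = 1 := by
  rw [sgn, ← mul_pow]; simp

theorem sgn_add_single (i l : Fin n) (d : Fin n →₀ ℕ) :
    sgn k i (d + single l 1) = sgn k i d * if l < i then -1 else 1 := by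
  rw [sgn, crossing_add_right, crossing_single_single, pow_add, sgn]
  split_ifs <;> simp

theorem sgn_eq_one {i : Fin n} {d : Fin n →₀ ℕ} (h : ∀ l < i, d l = 0) : sgn k i d = 1 := by
  rw [sgn, crossing_single_left_eq_zero h, pow_zero]

/-! ### Raising and lowering operators -/

variable (k) in
/-- Left multiplication by a variable in the skew polynomial ring. -/
noncomputable def raising (i : Fin n) : Module.End k (MvPolynomial (Fin n) k) :=
  (basisMonomials (Fin n) k).constr k fun d => sgn k i d • monomial (d + single i 1) 1

variable (k) in
/-- The odd derivation of the skew polynomial ring killing squares of variables. -/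
noncomputable def lowering (i : Fin n) : Module.End k (MvPolynomial (Fin n) k) :=
  (basisMonomials (Fin n) k).constr k fun d =>
    if Odd (d i) then sgn k i d • monomial (d - single i 1) 1 else 0

theorem raising_monomial (i : Fin n) (d : Fin n →₀ ℕ) :
    raising k i (monomial d 1) = sgn k i d • monomial (d + single i 1) 1 := by
  have := Module.Basis.constr_basis (basisMonomials (Fin n) k) k
    (fun d => sgn k i d • monomial (d + single i 1) (1 : k)) d
  rwa [coe_basisMonomials] at this

theorem lowering_monomial (i : Fin n) (d : Fin n →₀ ℕ) :
    lowering k i (monomial d 1) =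
      if Odd (d i) then sgn k i d • monomial (d - single i 1) 1 else 0 := by
  have := Module.Basis.constr_basis (basisMonomials (Fin n) k) k
    (fun d => if Odd (d i) then sgn k i d • monomial (d - single i 1) (1 : k) else 0) d
  rwa [coe_basisMonomials] at this

theorem lowering_monomial_of_even {i : Fin n} {d : Fin n →₀ ℕ} (h : Even (d i)) :
    lowering k i (monomial d 1) = 0 := by
  rw [lowering_monomial, if_neg (Nat.not_odd_iff_even.2 h)]

theorem lowering_monomial_add_single {i : Fin n} {d : Fin n →₀ ℕ} (h : Even (d i)) :
    lowering k i (monomial (d + single i 1) 1) = sgn k i d • monomial d 1 := by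
  have : Odd ((d + single i 1 : Fin n →₀ ℕ) i) := by simpa using h.add_one
  rw [lowering_monomial, if_pos this, add_tsub_cancel_right, sgn_add_single]
  simp

theorem exists_eq_add_single {i : Fin n} {d : Fin n →₀ ℕ} (h : ¬ Even (d i)) :
    ∃ e : Fin n →₀ ℕ, d = e + single i 1 ∧ Even (e i) := by
  have hd : d i ≠ 0 := fun h0 => h (by simp [h0])
  have hle : single i 1 ≤ d := by rw [Finsupp.single_le_iff]; omega
  have he := (tsub_add_cancel_of_le hle).symm
  refine ⟨d - single i 1, he, ?_⟩
  have := DFunLike.congr_fun he i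
  rw [Finsupp.add_apply, Finsupp.single_eq_same] at this
  rw [this, Nat.even_add_one, not_not] at h
  exact h

/-- Exactly one of the two orders of multiplication picks up an extra sign: the one in which the
larger index has to pass the smaller. -/
theorem raising_anticomm {i l : Fin n} (h : i ≠ l) :
    raising k i * raising k l + raising k l * raising k i = 0 := by
  refine (basisMonomials (Fin n) k).ext fun d => ?_
  simp only [coe_basisMonomials, LinearMap.add_apply, Module.End.mul_apply, raising_monomial,
    map_smul, sgn_add_single, smul_smul, LinearMap.zero_apply, add_right_comm d (single i 1),
    ← add_smul]
  rcases lt_or_gt_of_ne h with h | h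
  · rw [if_pos h, if_neg h.asymm]
    convert zero_smul k _ using 2
    ring
  · rw [if_pos h, if_neg h.asymm]
    convert zero_smul k _ using 2
    ring

theorem even_add_single_iff {i l : Fin n} (h : i ≠ l) (d : Fin n →₀ ℕ) :
    Even ((d + single l 1 : Fin n →₀ ℕ) i) ↔ Even (d i) := by
  rw [Finsupp.add_apply, Finsupp.single_eq_of_ne h, add_zero]

theorem lowering_anticomm (i l : Fin n) :
    lowering k i * lowering k l + lowering k l * lowering k i = 0 := by
  refine (basisMonomials (Fin n) k).ext fun d => ?_
  simp only [coe_basisMonomials, LinearMap.add_apply, Module.End.mul_apply, LinearMap.zero_apply]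
  by_cases h : i = l
  · subst h
    by_cases hd : Even (d i)
    · simp [lowering_monomial_of_even hd]
    · obtain ⟨e, rfl, he⟩ := exists_eq_add_single hd
      simp [lowering_monomial_add_single he, lowering_monomial_of_even he]
  · by_cases hi : Even (d i)
    · rw [lowering_monomial_of_even hi, map_zero, add_zero]
      by_cases hl : Even (d l)
      · rw [lowering_monomial_of_even hl, map_zero]
      · obtain ⟨e, rfl, he⟩ := exists_eq_add_single hl
        rw [even_add_single_iff h] at hi
        rw [lowering_monomial_add_single he, map_smul, lowering_monomial_of_even hi, smul_zero]
    · obtain ⟨e, rfl, he⟩ := exists_eq_add_single hi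
      rw [lowering_monomial_add_single he]
      rw [map_smul]
      by_cases hl : Even (e l)
      · have hl' := (even_add_single_iff (Ne.symm h) e).2 hl
        rw [lowering_monomial_of_even hl, lowering_monomial_of_even hl', map_zero, smul_zero,
          add_zero]
      · obtain ⟨g, rfl, hg⟩ := exists_eq_add_single hl
        rw [even_add_single_iff h] at he
        have hg' := (even_add_single_iff (Ne.symm h) g).2 hg
        rw [lowering_monomial_add_single hg, add_right_comm, lowering_monomial_add_single hg',
          map_smul, lowering_monomial_add_single he, smul_smul, smul_smul,
          sgn_add_single, sgn_add_single, ← add_smul]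
        convert zero_smul k _ using 2
        rcases lt_or_gt_of_ne h with h | h
        · rw [if_pos h, if_neg h.asymm]; ring
        · rw [if_pos h, if_neg h.asymm]; ring

theorem lowering_raising_of_ne {i l : Fin n} (h : i ≠ l) :
    lowering k i * raising k l + raising k l * lowering k i = 0 := by
  refine (basisMonomials (Fin n) k).ext fun d => ?_
  simp only [coe_basisMonomials, LinearMap.add_apply, Module.End.mul_apply, LinearMap.zero_apply,
    raising_monomial, map_smul]
  by_cases hi : Even (d i)
  · rw [lowering_monomial_of_even hi, lowering_monomial_of_even ((even_add_single_iff h d).2 hi),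
      map_zero, smul_zero, add_zero]
  · obtain ⟨e, rfl, he⟩ := exists_eq_add_single hi
    rw [lowering_monomial_add_single he, add_right_comm,
      lowering_monomial_add_single ((even_add_single_iff h e).2 he), map_smul, raising_monomial,
      smul_smul, smul_smul, sgn_add_single, sgn_add_single, ← add_smul]
    convert zero_smul k _ using 2
    rcases lt_or_gt_of_ne h with h | h
    · rw [if_pos h, if_neg h.asymm]; ring
    · rw [if_pos h, if_neg h.asymm]; ring

/-- Exactly one summand survives on a monomial, according to the parity of its `i`-th exponent, and
there the sign occurs squared. -/
theorem lowering_raising_self (i : Fin n) :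
    lowering k i * raising k i + raising k i * lowering k i = 1 := by
  refine (basisMonomials (Fin n) k).ext fun d => ?_
  simp only [coe_basisMonomials, LinearMap.add_apply, Module.End.mul_apply, Module.End.one_apply,
    raising_monomial, map_smul]
  by_cases hi : Even (d i)
  · rw [lowering_monomial_of_even hi, lowering_monomial_add_single hi, smul_smul, sgn_mul_self,
      one_smul, map_zero, add_zero]
  · obtain ⟨e, rfl, he⟩ := exists_eq_add_single hi
    have h2 : Even ((e + single i 1 + single i 1 : Fin n →₀ ℕ) i) := by
      simp only [Finsupp.add_apply, Finsupp.single_eq_same]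
      exact he.add_one.add_one
    rw [lowering_monomial_add_single he, lowering_monomial_of_even h2, smul_zero, zero_add,
      map_smul, raising_monomial, smul_smul, sgn_mul_self, one_smul]

theorem lowering_raising (i l : Fin n) :
    lowering k i * raising k l + raising k l * lowering k i = if i = l then 1 else 0 := by
  split_ifs with h
  · exact h ▸ lowering_raising_self i
  · exact lowering_raising_of_ne h

variable (a : Fin n → Fin n → k)

/-- The lower order part of left multiplication by `x_i` on ordered monomials. -/
noncomputable def correction (i : Fin n) : Module.End k (MvPolynomial (Fin n) k) :=
  ∑ j, (if j < i then a j i else 0) • lowering k j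

/-- Left multiplication by `x_i` on ordered monomials. -/
noncomputable def action (i : Fin n) : Module.End k (MvPolynomial (Fin n) k) :=
  raising k i + correction a i

theorem correction_anticomm (i l : Fin n) :
    correction a i * correction a l + correction a l * correction a i = 0 := by
  simp only [correction, Finset.sum_mul_sum]
  rw [Finset.sum_comm (γ := Fin n) (s := Finset.univ) (t := Finset.univ)
    (f := fun j m => ((if j < l then a j l else 0) • lowering k j) *
      ((if m < i then a m i else 0) • lowering k m)), ← Finset.sum_add_distrib]
  refine Finset.sum_eq_zero fun j _ => ?_
  rw [← Finset.sum_add_distrib]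
  refine Finset.sum_eq_zero fun m _ => ?_
  rw [smul_mul_smul_comm, smul_mul_smul_comm, mul_comm (if m < l then a m l else 0), ← smul_add,
    lowering_anticomm, smul_zero]

theorem correction_raising (i l : Fin n) :
    correction a i * raising k l + raising k l * correction a i =
      algebraMap k _ (if l < i then a l i else 0) := by
  simp only [correction, Finset.sum_mul, Finset.mul_sum, ← Finset.sum_add_distrib,
    smul_mul_assoc, mul_smul_comm, ← smul_add, lowering_raising]
  simp [Algebra.algebraMap_eq_smul_one]

/-- The scalar comes only from the correction at the larger index `l`, which contains `lowering k i`
with coefficient `a i l`; all other mixed terms cancel. -/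
theorem action_anticomm {i l : Fin n} (h : i < l) :
    action a i * action a l + action a l * action a i = algebraMap k _ (a i l) := by
  have h1 := correction_raising a l i
  have h2 := correction_raising a i l
  have h3 := correction_anticomm a i l
  have h4 := raising_anticomm (k := k) h.ne
  rw [if_pos h] at h1
  rw [if_neg h.asymm, map_zero] at h2
  rw [← h1]
  calc _ = (raising k i * raising k l + raising k l * raising k i) +
        (correction a l * raising k i + raising k i * correction a l) +
        (correction a i * raising k l + raising k l * correction a i) +
        (correction a i * correction a l + correction a l * correction a i) := by
          simp only [action]; noncomm_ring
    _ = _ := by rw [h2, h3, h4]; simp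

/-! ### Universal property and coordinates in ordered monomials -/

/-- The generators of `V a`. -/
def gen (i : Fin n) : V a := RingQuot.mkAlgHom k (Rel a) (FreeAlgebra.ι k i)

theorem gen_anticomm {i l : Fin n} (h : i < l) :
    gen a i * gen a l + gen a l * gen a i = algebraMap k _ (a i l) := by
  have := RingQuot.mkAlgHom_rel k (Rel.anticomm (a := a) i l h)
  simpa [gen] using this

theorem gen_anticomm_of_ne {i l : Fin n} (h : i ≠ l) :
    gen a i * gen a l + gen a l * gen a i = algebraMap k _ (entry a i l) := by
  rcases lt_or_gt_of_ne h with h | h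
  · rw [gen_anticomm a h, entry, if_pos h]
  · rw [add_comm, gen_anticomm a h, entry, if_neg h.asymm]

/-- The universal property of `V a`. -/
noncomputable def lift {B : Type*} [Ring B] [Algebra k B] (u : Fin n → B)
    (h : ∀ i l, i < l → u i * u l + u l * u i = algebraMap k B (a i l)) : V a →ₐ[k] B :=
  RingQuot.liftAlgHom k ⟨FreeAlgebra.lift k u, by
    rintro _ _ ⟨i, l, hil⟩
    simpa using h i l hil⟩

theorem lift_gen {B : Type*} [Ring B] [Algebra k B] (u : Fin n → B)
    (h : ∀ i l, i < l → u i * u l + u l * u i = algebraMap k B (a i l)) (i : Fin n) :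
    lift a u h (gen a i) = u i := by
  simp [lift, gen]

theorem algHom_ext {B : Type*} [Ring B] [Algebra k B] {f g : V a →ₐ[k] B}
    (h : ∀ i, f (gen a i) = g (gen a i)) : f = g :=
  RingQuot.ringQuot_ext' k _ _ (FreeAlgebra.hom_ext (funext h))

/-- The action of `V a` on polynomials modelling its left regular representation. -/
noncomputable def rep : V a →ₐ[k] Module.End k (MvPolynomial (Fin n) k) :=
  lift a (action a) fun _ _ h => action_anticomm a h

theorem rep_gen (i : Fin n) : rep a (gen a i) = action a i :=
  lift_gen a _ _ i

/-- The correction only lowers variables of index below `i`, and none occurs here; no sign arises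
for the same reason. -/
theorem action_monomial_of_forall {i : Fin n} {d : Fin n →₀ ℕ} (h : ∀ l < i, d l = 0) :
    action a i (monomial d 1) = monomial (d + single i 1) 1 := by
  rw [action, LinearMap.add_apply, raising_monomial, sgn_eq_one h, one_smul, correction,
    LinearMap.sum_apply, Finset.sum_eq_zero, add_zero]
  intro j _
  split_ifs with hj
  · rw [LinearMap.smul_apply, lowering_monomial_of_even (by simp [h j hj]), smul_zero]
  · simp

theorem gen_mul_orderedEval_monomial {i : Fin n} {d : Fin n →₀ ℕ} (h : ∀ l < i, d l = 0) :
    gen a i * orderedEval (gen a) (monomial d (1 : k)) =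
      orderedEval (gen a) (action a i (monomial d 1)) := by
  rw [action_monomial_of_forall a h, orderedEval_monomial, orderedEval_monomial,
    word_add_single _ h]

/-- Raising at `i > j` and lowering create no variable below `j`, so `gen_mul_orderedEval_monomial`
applies term by term. -/
theorem gen_mul_orderedEval_action_monomial {i j : Fin n} (hj : j < i) {d : Fin n →₀ ℕ}
    (h : ∀ l < j, d l = 0) :
    gen a j * orderedEval (gen a) (action a i (monomial d 1)) =
      orderedEval (gen a) (action a j (action a i (monomial d 1))) := by
  simp only [action.eq_1 a i, LinearMap.add_apply, map_add, mul_add]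
  congr 1
  · rw [raising_monomial, map_smul, map_smul, map_smul, mul_smul_comm,
      gen_mul_orderedEval_monomial]
    intro l hl
    rw [Finsupp.add_apply, h l hl, Finsupp.single_eq_of_ne (hl.trans hj).ne, add_zero]
  · simp only [correction, LinearMap.sum_apply, map_sum, Finset.mul_sum, LinearMap.smul_apply,
      map_smul, mul_smul_comm, lowering_monomial]
    refine Finset.sum_congr rfl fun m _ => ?_
    congr 1
    split_ifs
    · rw [map_smul, map_smul, map_smul, mul_smul_comm, gen_mul_orderedEval_monomial]
      intro l hl
      rw [Finsupp.tsub_apply, h l hl, Nat.zero_sub]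
    · simp

theorem gen_mul_orderedEval (i : Fin n) (p : MvPolynomial (Fin n) k) :
    gen a i * orderedEval (gen a) p = orderedEval (gen a) (action a i p) := by
  suffices LinearMap.mulLeft k (gen a i) ∘ₗ orderedEval (gen a) =
      orderedEval (gen a) ∘ₗ action a i from LinearMap.congr_fun this p
  refine (basisMonomials (Fin n) k).ext fun d => ?_
  simp only [coe_basisMonomials, LinearMap.comp_apply, LinearMap.mulLeft_apply]
  induction d using exponent_induction with
  | zero => exact gen_mul_orderedEval_monomial a fun _ _ => rfl
  | add j d hd ih =>
    rcases le_or_gt i j with hij | hij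
    · refine gen_mul_orderedEval_monomial a fun l hl => ?_
      rw [Finsupp.add_apply, hd l (hl.trans_le hij),
        Finsupp.single_eq_of_ne (hl.trans_le hij).ne, add_zero]
    -- The leading variable `j` is smaller than `i`: the same anticommutation relation, in `V a` and
    -- for the operators, moves `i` past `j` and reduces to `d`.
    · have h1 := gen_anticomm a hij
      have h2 := LinearMap.congr_fun (action_anticomm a hij) (monomial d 1)
      rw [LinearMap.add_apply, Module.End.mul_apply, Module.End.mul_apply,
        action_monomial_of_forall a hd, ← eq_sub_iff_add_eq'] at h2
      rw [← eq_sub_iff_add_eq'] at h1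
      rw [h2, map_sub, ← gen_mul_orderedEval_action_monomial a hij hd, ← ih,
        orderedEval_monomial, word_add_single _ hd, ← mul_assoc, h1, sub_mul, mul_assoc,
        orderedEval_monomial, Module.algebraMap_end_apply, map_smul, Algebra.smul_def,
        orderedEval_monomial]

theorem mul_orderedEval (v : V a) (p : MvPolynomial (Fin n) k) :
    v * orderedEval (gen a) p = orderedEval (gen a) (rep a v p) := by
  obtain ⟨w, rfl⟩ := RingQuot.mkAlgHom_surjective k (Rel a) v
  induction w using FreeAlgebra.induction generalizing p with
  | grade0 r =>
    rw [AlgHom.commutes, AlgHom.commutes, Module.algebraMap_end_apply, map_smul, Algebra.smul_def]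
  | grade1 i =>
    change gen a i * _ = orderedEval (gen a) (rep a (gen a i) p)
    rw [rep_gen, gen_mul_orderedEval]
  | mul x y hx hy => rw [map_mul, mul_assoc, hy, hx, map_mul, Module.End.mul_apply]
  | add x y hx hy => rw [map_add, add_mul, hx, hy, map_add, LinearMap.add_apply, map_add]

/-- The coordinates of an element of `V a` in the basis of ordered monomials. -/
noncomputable def symbol : V a →ₗ[k] MvPolynomial (Fin n) k :=
  LinearMap.applyₗ (1 : MvPolynomial (Fin n) k) ∘ₗ (rep a).toLinearMap

theorem symbol_apply (v : V a) : symbol a v = rep a v 1 := rfl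

theorem symbol_mul (v w : V a) : symbol a (v * w) = rep a v (symbol a w) := by
  simp [symbol_apply]

/-- This is `mul_orderedEval` at the polynomial `1`. It shows that ordered monomials span and that
`symbol` loses no information. -/
theorem orderedEval_symbol (v : V a) : orderedEval (gen a) (symbol a v) = v := by
  have h1 : orderedEval (gen a) (1 : MvPolynomial (Fin n) k) = 1 := by
    have := orderedEval_monomial (k := k) (gen a) 0
    rwa [word_zero] at this
  rw [symbol_apply, ← mul_orderedEval, h1, mul_one]

theorem symbol_injective : Function.Injective (symbol a) :=
  Function.LeftInverse.injective (orderedEval_symbol a)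

theorem symbol_algebraMap (c : k) : symbol a (algebraMap k _ c) = C c := by
  rw [symbol_apply, AlgHom.commutes, Module.algebraMap_end_apply, ← mul_one (C c), C_mul']

theorem symbol_gen (i : Fin n) : symbol a (gen a i) = X i := by
  have := action_monomial_of_forall a (i := i) (d := 0) fun _ _ => rfl
  rw [zero_add] at this
  rw [symbol_apply, rep_gen]
  exact this

end Representation

/-! ### Leading terms of products -/

section LeadingTerms

variable {k : Type*} [CommRing k] {n : ℕ} {m : MonomialOrder (Fin n)}

/-- All exponents of `p` are at most `α`, and the (possibly zero) coefficient at `α` is `c`. -/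
def IsLead (m : MonomialOrder (Fin n)) (p : MvPolynomial (Fin n) k) (α : Fin n →₀ ℕ) (c : k) :
    Prop :=
  p.coeff α = c ∧ ∀ β, m.toSyn α < m.toSyn β → p.coeff β = 0

theorem isLead_degree (m : MonomialOrder (Fin n)) (p : MvPolynomial (Fin n) k) :
    IsLead m p (m.degree p) (m.leadingCoeff p) :=
  ⟨rfl, fun _ h => m.coeff_eq_zero_of_lt h⟩

theorem isLead_zero (α : Fin n →₀ ℕ) : IsLead m (0 : MvPolynomial (Fin n) k) α 0 :=
  ⟨coeff_zero α, fun β _ => coeff_zero β⟩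

theorem isLead_monomial (d : Fin n →₀ ℕ) (c : k) : IsLead m (monomial d c) d c := by
  refine ⟨by simp, fun β h => ?_⟩
  rw [coeff_monomial, if_neg]
  rintro rfl
  exact lt_irrefl _ h

namespace IsLead

variable {p q : MvPolynomial (Fin n) k} {α β : Fin n →₀ ℕ} {c c' : k}

theorem add (hp : IsLead m p α c) (hq : IsLead m q α c') : IsLead m (p + q) α (c + c') :=
  ⟨by rw [coeff_add, hp.1, hq.1], fun β h => by rw [coeff_add, hp.2 β h, hq.2 β h, add_zero]⟩

theorem smul (r : k) (hp : IsLead m p α c) : IsLead m (r • p) α (r * c) :=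
  ⟨by rw [coeff_smul, hp.1, smul_eq_mul], fun β h => by rw [coeff_smul, hp.2 β h, smul_zero]⟩

theorem sum {ι : Type*} {s : Finset ι} {f : ι → MvPolynomial (Fin n) k} {c : ι → k}
    (h : ∀ i ∈ s, IsLead m (f i) α (c i)) : IsLead m (∑ i ∈ s, f i) α (∑ i ∈ s, c i) := by
  refine ⟨?_, fun β hβ => ?_⟩
  · rw [coeff_sum]
    exact Finset.sum_congr rfl fun i hi => (h i hi).1
  · rw [coeff_sum]
    exact Finset.sum_eq_zero fun i hi => (h i hi).2 β hβ

theorem of_lt (hp : IsLead m p α c) (h : m.toSyn α < m.toSyn β) : IsLead m p β 0 :=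
  ⟨hp.2 β h, fun γ hγ => hp.2 γ (h.trans hγ)⟩

theorem eq_of_ne_zero (hp : IsLead m p α c) (hq : IsLead m p β c') (hc : c ≠ 0) (hc' : c' ≠ 0) :
    α = β := by
  refine m.toSyn.injective (le_antisymm (not_lt.1 fun h => ?_) (not_lt.1 fun h => ?_))
  · exact hc (hp.1.symm.trans (hq.2 α h))
  · exact hc' (hq.1.symm.trans (hp.2 β h))

theorem le_of_coeff_ne_zero (hp : IsLead m p α c) (hβ : p.coeff β ≠ 0) :
    m.toSyn β ≤ m.toSyn α :=
  not_lt.1 fun h => hβ (hp.2 β h)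

/-- Translation by `δ` preserves the order strictly, so smaller monomials of `p` cannot reach the
exponent `β + δ`. -/
theorem map {F : Module.End k (MvPolynomial (Fin n) k)} {δ : Fin n →₀ ℕ}
    {s : (Fin n →₀ ℕ) → k} (hF : ∀ d, IsLead m (F (monomial d 1)) (d + δ) (s d))
    (hp : IsLead m p β c) : IsLead m (F p) (β + δ) (s β * c) := by
  have h1 : F p = ∑ d ∈ p.support, p.coeff d • F (monomial d 1) := by
    conv_lhs => rw [p.as_sum, map_sum]
    refine Finset.sum_congr rfl fun d _ => ?_
    rw [← map_smul, smul_monomial, smul_eq_mul, mul_one]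
  have h2 : s β * c = ∑ d ∈ p.support, if d = β then s β * c else 0 := by
    rw [Finset.sum_ite_eq']
    split_ifs with h
    · rfl
    · rw [← hp.1, MvPolynomial.notMem_support_iff.1 h, mul_zero]
  rw [h1, h2]
  refine sum fun d hd => ?_
  split_ifs with h
  · subst h
    rw [← hp.1, mul_comm]
    exact (hF d).smul _
  · have hlt : m.toSyn (d + δ) < m.toSyn (β + δ) := by
      rw [map_add, map_add]
      refine add_lt_add_left (lt_of_le_of_ne
        (hp.le_of_coeff_ne_zero (MvPolynomial.mem_support_iff.1 hd))
          fun h' => h (m.toSyn.injective h')) _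
    rw [← mul_zero (p.coeff d)]
    exact ((hF d).of_lt hlt).smul _

end IsLead

variable (a : Fin n → Fin n → k)

/-- Correction terms have exponents componentwise below `d`, and every monomial order refines the
componentwise order. -/
theorem isLead_action_monomial (i : Fin n) (d : Fin n →₀ ℕ) :
    IsLead m (action a i (monomial d 1)) (d + single i 1) (sgn k i d) := by
  have h : IsLead m (correction a i (monomial d 1)) (d + single i 1) 0 := by
    rw [correction, LinearMap.sum_apply]
    suffices h : ∀ j ∈ Finset.univ, IsLead m (((if j < i then a j i else 0) • lowering k j)
        (monomial d 1)) (d + single i 1) 0 by simpa using IsLead.sum h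
    intro j _
    rw [LinearMap.smul_apply, lowering_monomial]
    split_ifs with h1 h2
    · have := ((isLead_monomial (m := m) (d - single j 1) (1 : k)).of_lt
        (β := d + single i 1) (m.toSyn_strictMono ?_)).smul (a j i * sgn k j d)
      · rwa [mul_zero, ← smul_smul] at this
      · refine lt_of_le_of_lt tsub_le_self (lt_of_le_of_ne le_self_add fun h' => ?_)
        simpa using DFunLike.congr_fun h' i
    · rw [smul_zero]; exact isLead_zero _
    · rw [zero_smul]; exact isLead_zero _
    · rw [zero_smul]; exact isLead_zero _
  rw [action, LinearMap.add_apply, raising_monomial]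
  simpa using ((isLead_monomial (d + single i 1) (1 : k)).smul (sgn k i d)).add h

theorem isLead_rep_word (d : Fin n →₀ ℕ) {p : MvPolynomial (Fin n) k} {β : Fin n →₀ ℕ} {c : k}
    (hp : IsLead m p β c) :
    IsLead m (rep a (word (gen a) d) p) (d + β) ((-1) ^ crossing d β * c) := by
  induction d using exponent_induction with
  | zero => simpa [word_zero, crossing_zero_left] using hp
  | add j d hd ih =>
    have h := ih.map (isLead_action_monomial a j)
    have h1 : sgn k j (d + β) * ((-1) ^ crossing d β * c) =
        (-1) ^ crossing (d + single j 1) β * c := by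
      rw [sgn, crossing_add_right, crossing_single_left_eq_zero hd, crossing_add_left, zero_add,
        pow_add]
      ring
    rwa [h1, add_right_comm, ← rep_gen, ← Module.End.mul_apply, ← map_mul,
      ← word_add_single _ hd] at h

theorem isLead_symbol_mul {v w : V a} {α β : Fin n →₀ ℕ} {c c' : k}
    (hv : IsLead m (symbol a v) α c) (hw : IsLead m (symbol a w) β c') :
    IsLead m (symbol a (v * w)) (α + β) ((-1) ^ crossing α β * c' * c) := by
  -- Right multiplication by `w`, read in coordinates; it shifts every leading exponent by `β`.
  let F : Module.End k (MvPolynomial (Fin n) k) :=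
    LinearMap.applyₗ (symbol a w) ∘ₗ (rep a).toLinearMap ∘ₗ orderedEval (gen a)
  have hF : ∀ d, IsLead m (F (monomial d 1)) (d + β) ((-1) ^ crossing d β * c') := fun d => by
    have := isLead_rep_word a d hw
    rwa [← orderedEval_monomial (k := k)] at this
  have := hv.map hF
  have hFv : F (symbol a v) = symbol a (v * w) := by
    rw [symbol_mul]
    simp only [F, LinearMap.comp_apply, orderedEval_symbol]
    rfl
  rwa [hFv] at this

theorem isLead_symbol_word [IsDomain k] {u : Fin n → V a} {α : Fin n → Fin n →₀ ℕ} {c : Fin n → k}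
    (hu : ∀ i, IsLead m (symbol a (u i)) (α i) (c i)) (hc : ∀ i, c i ≠ 0) (d : Fin n →₀ ℕ) :
    ∃ s ≠ 0, IsLead m (symbol a (word u d)) (∑ i, d i • α i) s := by
  induction d using exponent_induction with
  | zero =>
    refine ⟨1, one_ne_zero, ?_⟩
    have := isLead_monomial (m := m) (0 : Fin n →₀ ℕ) (1 : k)
    simpa [word_zero, symbol_apply] using this
  | add j d hd ih =>
    obtain ⟨s, hs, h⟩ := ih
    refine ⟨(-1) ^ crossing (α j) (∑ i, d i • α i) * s * c j, ?_, ?_⟩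
    · exact mul_ne_zero (mul_ne_zero (pow_ne_zero _ (neg_ne_zero.2 one_ne_zero)) hs) (hc j)
    · rw [word_add_single _ hd]
      have h1 : ∑ i, (d + single j 1 : Fin n →₀ ℕ) i • α i = α j + ∑ i, d i • α i := by
        simp only [Finsupp.add_apply, add_smul, Finset.sum_add_distrib]
        rw [add_comm]
        congr 1
        rw [Finset.sum_eq_single j]
        · simp
        · intro b _ hb
          rw [Finsupp.single_eq_of_ne hb, zero_smul]
        · simp
      rw [h1]
      exact isLead_symbol_mul a (hu j) h

/-- By `hα` different words have different leading exponents, so the largest one occurring in `p`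
survives uncancelled. -/
theorem exists_isLead_symbol_orderedEval [IsDomain k] {u : Fin n → V a}
    {α : Fin n → Fin n →₀ ℕ} {c : Fin n → k}
    (hu : ∀ i, IsLead m (symbol a (u i)) (α i) (c i)) (hc : ∀ i, c i ≠ 0)
    (hα : Function.Injective fun d : Fin n →₀ ℕ => ∑ i, d i • α i)
    {p : MvPolynomial (Fin n) k} (hp : p ≠ 0) :
    ∃ d : Fin n →₀ ℕ, ∃ s ≠ 0,
      IsLead m (symbol a (orderedEval u p)) (∑ i, d i • α i) s := by
  choose s hs hlead using isLead_symbol_word a hu hc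
  obtain ⟨d, hd, hmax⟩ := p.support.exists_max_image (fun d => m.toSyn (∑ i, d i • α i))
    (Finset.nonempty_iff_ne_empty.2 (mt MvPolynomial.support_eq_empty.1 hp))
  refine ⟨d, p.coeff d * s d, mul_ne_zero (MvPolynomial.mem_support_iff.1 hd) (hs d), ?_⟩
  have h1 : symbol a (orderedEval u p) =
      ∑ e ∈ p.support, p.coeff e • symbol a (word u e) := by
    conv_lhs => rw [p.as_sum, map_sum, map_sum]
    refine Finset.sum_congr rfl fun e _ => ?_
    rw [← orderedEval_monomial (k := k), ← map_smul, ← map_smul, smul_monomial, smul_eq_mul,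
      mul_one]
  have h2 : p.coeff d * s d =
      ∑ e ∈ p.support, if e = d then p.coeff d * s d else 0 := by
    rw [Finset.sum_ite_eq', if_pos hd]
  rw [h1, h2]
  refine IsLead.sum fun e he => ?_
  split_ifs with h
  · subst h
    exact (hlead e).smul _
  · have hlt : m.toSyn (∑ i, e i • α i) < m.toSyn (∑ i, d i • α i) :=
      lt_of_le_of_ne (hmax e he) fun h' => h (hα (m.toSyn.injective h'))
    rw [← mul_zero (p.coeff e)]
    exact ((hlead e).of_lt hlt).smul _

end LeadingTerms

/-! ### Parity of the leading exponents and a bilinear form modulo 2 -/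

section Parity

variable {n : ℕ}

/-- With equal signs the two products would add up to twice a nonzero term at `α + β`, which is not
the constant exponent. -/
theorem odd_crossing_of_anticomm {k : Type*} [CommRing k] [IsDomain k] (h2 : (2 : k) ≠ 0)
    {m : MonomialOrder (Fin n)} (a : Fin n → Fin n → k) {v w : V a} {α β : Fin n →₀ ℕ} {c c' r : k}
    (hv : IsLead m (symbol a v) α c) (hw : IsLead m (symbol a w) β c') (hc : c ≠ 0)
    (hc' : c' ≠ 0) (hα : α ≠ 0) (h : v * w + w * v = algebraMap k _ r) :
    Odd (crossing α β + crossing β α) := by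
  have h1 := (isLead_symbol_mul a hv hw).1
  have h3 := (isLead_symbol_mul a hw hv).1
  have h4 := congrArg (fun z => coeff (α + β) (symbol a z)) h
  have h5 : 0 ≠ α + β := fun h0 => hα (by
    ext i
    have := DFunLike.congr_fun h0 i
    simp only [Finsupp.add_apply, Finsupp.zero_apply] at this ⊢
    omega)
  simp only [map_add, coeff_add, symbol_algebraMap, coeff_C, if_neg h5] at h4
  rw [h1, add_comm α β, h3] at h4
  by_contra hodd
  rw [Nat.not_odd_iff_even] at hodd
  have h6 : ((-1 : k)) ^ crossing α β = (-1) ^ crossing β α := by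
    have h7 : (-1 : k) ^ crossing β α * (-1) ^ crossing β α = 1 := by rw [← mul_pow]; simp
    have h9 : (-1 : k) ^ (crossing α β + crossing β α) = 1 := hodd.neg_one_pow
    rw [pow_add] at h9
    linear_combination (-1 : k) ^ crossing β α * h9 - (-1 : k) ^ crossing α β * h7
  rw [h6] at h4
  have h7 : 2 * ((-1) ^ crossing β α * c' * c) = 0 := by linear_combination h4
  exact mul_ne_zero h2 (mul_ne_zero (mul_ne_zero (pow_ne_zero _ (neg_ne_zero.2 one_ne_zero)) hc')
    hc) h7

/-- The matrix with zeros on the diagonal and ones elsewhere. -/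
def offDiag (n : ℕ) : Matrix (Fin n) (Fin n) (ZMod 2) := Matrix.of fun i j => if i = j then 0 else 1

/-- With `J` the all-ones matrix, `(J - 1)² = n J - 2 J + 1`, and both `n` and `2` vanish modulo 2.
-/
theorem offDiag_mul_self (hn : Even n) : offDiag n * offDiag n = 1 := by
  have h0 : (n : ZMod 2) = 0 := (ZMod.natCast_eq_zero_iff_even).2 hn
  have h : offDiag n = Matrix.of (fun _ _ => 1) - 1 := by
    ext i j
    simp only [offDiag, Matrix.of_apply, Matrix.sub_apply, Matrix.one_apply]
    split_ifs <;> simp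
  have hJ : (Matrix.of (fun _ _ => 1) : Matrix (Fin n) (Fin n) (ZMod 2)) *
      Matrix.of (fun _ _ => 1) = 0 := by
    ext i j
    simp [Matrix.mul_apply, h0]
  rw [h, sub_mul, mul_sub, mul_sub, hJ, mul_one, one_mul, one_mul]
  ext i j
  simp only [Matrix.sub_apply, Matrix.zero_apply, Matrix.of_apply]
  have : (1 : ZMod 2) + 1 = 0 := by decide
  linear_combination -this

/-- The two crossing numbers cover the pairs `y < x` and `x < y`, together all off-diagonal pairs.
-/
theorem mul_offDiag_mul_transpose (α : Fin n → Fin n →₀ ℕ) (i l : Fin n) :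
    ((Matrix.of fun i j => (α i j : ZMod 2)) * offDiag n *
      (Matrix.of fun i j => (α i j : ZMod 2)).transpose) i l =
      ((crossing (α i) (α l) + crossing (α l) (α i) : ℕ) : ZMod 2) := by
  simp only [Matrix.mul_apply, Matrix.transpose_apply, Matrix.of_apply, offDiag, crossing]
  push_cast
  rw [Finset.sum_comm (f := fun x y => if y < x then (α l x : ZMod 2) * (α i y : ZMod 2) else 0),
    ← Finset.sum_add_distrib]
  simp only [Finset.sum_mul]
  rw [Finset.sum_comm]
  refine Finset.sum_congr rfl fun x _ => ?_
  rw [← Finset.sum_add_distrib]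
  refine Finset.sum_congr rfl fun y _ => ?_
  rcases lt_trichotomy x y with h | h | h
  · simp [h, h.ne, h.asymm, mul_comm]
  · simp [h]
  · simp [h, h.ne', h.asymm]

theorem sum_smul_injective (hn : Even n) {α : Fin n → Fin n →₀ ℕ}
    (h : ∀ i l, i ≠ l → Odd (crossing (α i) (α l) + crossing (α l) (α i))) :
    Function.Injective fun d : Fin n →₀ ℕ => ∑ i, d i • α i := by
  set P : Matrix (Fin n) (Fin n) (ZMod 2) := Matrix.of fun i j => (α i j : ZMod 2) with hP
  have h1 : P * offDiag n * P.transpose = offDiag n := by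
    ext i l
    rw [hP, mul_offDiag_mul_transpose, offDiag, Matrix.of_apply]
    split_ifs with hil
    · subst hil
      exact (ZMod.natCast_eq_zero_iff_even).2 (Even.add_self _)
    · exact (ZMod.natCast_eq_one_iff_odd).2 (h i l hil)
  have h2 : P * (offDiag n * P.transpose * offDiag n) = 1 := by
    rw [← mul_assoc, ← mul_assoc, h1, offDiag_mul_self hn]
  have h3 : P.det ≠ 0 := fun h0 => by
    have := congrArg Matrix.det h2
    rw [Matrix.det_mul, h0, zero_mul, Matrix.det_one] at this
    exact zero_ne_one this
  set A : Matrix (Fin n) (Fin n) ℤ := Matrix.of fun i j => (α i j : ℤ) with hA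
  -- The integer determinant reduces to the nonzero determinant of `P` modulo 2.
  have h4 : A.det ≠ 0 := fun h0 => h3 (by
    have := (Int.castRingHom (ZMod 2)).map_det A
    rw [h0, map_zero] at this
    rw [this]
    congr 1)
  intro d e hde
  have h5 : Matrix.vecMul (fun i => (d i : ℤ) - e i) A = 0 := by
    ext j
    have := congrArg (fun g : Fin n →₀ ℕ => ((g j : ℕ) : ℤ)) hde
    simp only [Finsupp.finsetSum_apply, Finsupp.smul_apply, smul_eq_mul] at this
    push_cast at this
    simp only [Matrix.vecMul, dotProduct, hA, Matrix.of_apply, sub_mul, Finset.sum_sub_distrib,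
      Pi.zero_apply]
    exact sub_eq_zero.2 this
  have h6 := Matrix.eq_zero_of_vecMul_eq_zero h4 h5
  ext i
  have := congrFun h6 i
  simp only [Pi.zero_apply] at this
  omega

end Parity

/-! ### Anticommutators of affine elements -/

section Affine

variable {k : Type*} [CommRing k] {n : ℕ} (a : Fin n → Fin n → k)

theorem symbol_gen_mul_self (i : Fin n) :
    symbol a (gen a i * gen a i) = monomial (single i 2) 1 := by
  rw [symbol_mul, symbol_gen, rep_gen, X, action_monomial_of_forall a fun l hl =>
    Finsupp.single_eq_of_ne hl.ne, ← Finsupp.single_add]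

theorem coeff_symbol_gen_anticomm {d : Fin n →₀ ℕ} (hd : d ≠ 0) (i l : Fin n) :
    coeff d (symbol a (gen a i * gen a l + gen a l * gen a i)) =
      if i = l then 2 * coeff d (monomial (single i 2) (1 : k)) else 0 := by
  split_ifs with h
  · subst h
    rw [map_add, symbol_gen_mul_self, coeff_add, two_mul]
  · rw [gen_anticomm_of_ne a h, symbol_algebraMap, coeff_C, if_neg hd.symm]

/-- An affine combination of the generators. -/
noncomputable def affine (c : k) (b : Fin n → k) : V a :=
  algebraMap k _ c + ∑ j, b j • gen a j

theorem symbol_affine (c : k) (b : Fin n → k) :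
    symbol a (affine a c b) = C c + ∑ j, b j • X j := by
  simp only [affine, map_add, map_sum, map_smul, symbol_algebraMap, symbol_gen]

theorem coeff_single_symbol_affine (c : k) (b : Fin n → k) (q : Fin n) :
    coeff (single q 1) (symbol a (affine a c b)) = b q := by
  have h : (0 : Fin n →₀ ℕ) ≠ single q 1 := (Finsupp.single_ne_zero.2 one_ne_zero).symm
  simp [symbol_affine, coeff_C, h, coeff_sum, coeff_X, Finsupp.single_left_inj]

theorem eq_affine {v : V a} (h : ∀ d : Fin n →₀ ℕ, 1 < d.degree → coeff d (symbol a v) = 0) :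
    v = affine a (coeff 0 (symbol a v)) fun j => coeff (single j 1) (symbol a v) := by
  apply symbol_injective a
  ext d
  by_cases h0 : d = 0
  · subst h0
    simp [symbol_affine, coeff_sum, coeff_X]
  · by_cases h1 : d.degree = 1
    · obtain ⟨q, rfl⟩ := (Finsupp.sum_eq_one_iff d).1 h1
      rw [coeff_single_symbol_affine]
    · have hd : 1 < d.degree := by
        have := mt (Finsupp.degree_eq_zero_iff d).1 h0
        omega
      have h2 : ∀ j, single j 1 ≠ d := by
        rintro j rfl
        exact h1 (Finsupp.degree_single j 1)
      simp [h d hd, symbol_affine, coeff_sum, coeff_C, coeff_X, h2, Ne.symm h0]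

theorem affine_anticomm (c c' : k) (b b' : Fin n → k) :
    affine a c b * affine a c' b' + affine a c' b' * affine a c b =
      algebraMap k _ (2 * c * c') + (2 * c) • (∑ j, b' j • gen a j) +
        (2 * c') • (∑ j, b j • gen a j) +
        ∑ i, ∑ l, (b i * b' l) • (gen a i * gen a l + gen a l * gen a i) := by
  have h : ∑ i, ∑ l, (b i * b' l) • (gen a i * gen a l + gen a l * gen a i) =
      (∑ j, b j • gen a j) * (∑ j, b' j • gen a j) +
        (∑ j, b' j • gen a j) * (∑ j, b j • gen a j) := by
    rw [Finset.sum_mul_sum, Finset.sum_mul_sum, Finset.sum_comm (f := fun i j =>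
      b' i • gen a i * b j • gen a j), ← Finset.sum_add_distrib]
    refine Finset.sum_congr rfl fun i _ => ?_
    rw [← Finset.sum_add_distrib]
    refine Finset.sum_congr rfl fun l _ => ?_
    rw [smul_mul_smul_comm, smul_mul_smul_comm, mul_comm (b' l), smul_add]
  rw [h]
  simp only [affine]
  generalize ∑ j, b j • gen a j = s
  generalize ∑ j, b' j • gen a j = t
  simp only [mul_add, add_mul, Algebra.smul_def, map_mul, map_ofNat]
  rw [← Algebra.commutes c' s, ← Algebra.commutes c t, Algebra.commutes c' (algebraMap k _ c)]
  noncomm_ring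

variable {a}

/-- The coefficient of the square of the `q`-th variable in the anticommutator is `2 * b q * b' q`.
-/
theorem mul_eq_zero_of_affine_anticomm [IsDomain k] (h2 : (2 : k) ≠ 0) {c c' r : k}
    {b b' : Fin n → k}
    (h : affine a c b * affine a c' b' + affine a c' b' * affine a c b = algebraMap k _ r)
    (q : Fin n) : b q * b' q = 0 := by
  have hq : single q 2 ≠ 0 := Finsupp.single_ne_zero.2 two_ne_zero
  have h1 := congrArg (fun z => coeff (single q 2) (symbol a z)) h
  rw [affine_anticomm] at h1
  have h3 : ∀ j, single j 1 ≠ single q 2 := fun j hj => by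
    simpa using congrArg Finsupp.degree hj
  simp only [map_add, map_sum, map_smul, coeff_add, coeff_sum, coeff_smul] at h1
  simp only [← coeff_add, ← map_add, coeff_symbol_gen_anticomm a hq, symbol_algebraMap, coeff_C,
    hq.symm, symbol_gen, coeff_X, h3, coeff_monomial, Finsupp.single_left_inj two_ne_zero] at h1
  simp at h1
  exact mul_eq_zero.2 (h1.resolve_right h2)

/-- Anticommutators of generators have no linear part, so linear terms arise only from the constants
`c` and `c'`. -/
theorem add_eq_zero_of_affine_anticomm [IsDomain k] (h2 : (2 : k) ≠ 0) {c c' r : k}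
    {b b' : Fin n → k}
    (h : affine a c b * affine a c' b' + affine a c' b' * affine a c b = algebraMap k _ r)
    (q : Fin n) : c * b' q + c' * b q = 0 := by
  have hq : single q 1 ≠ 0 := Finsupp.single_ne_zero.2 one_ne_zero
  have h1 := congrArg (fun z => coeff (single q 1) (symbol a z)) h
  rw [affine_anticomm] at h1
  have h3 : ∀ j, single j 2 ≠ single q 1 := fun j hj => by
    simpa using congrArg Finsupp.degree hj
  simp only [map_add, map_sum, map_smul, coeff_add, coeff_sum, coeff_smul] at h1
  simp only [← coeff_add, ← map_add, coeff_symbol_gen_anticomm a hq, symbol_algebraMap, coeff_C,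
    hq.symm, symbol_gen, coeff_X, h3, coeff_monomial, Finsupp.single_left_inj one_ne_zero] at h1
  simp at h1
  refine (mul_eq_zero.1 (?_ : 2 * (c * b' q + c' * b q) = 0)).resolve_left h2
  linear_combination h1

end Affine

/-! ### Isomorphisms permute the generators up to scalars -/

section Classification

variable {k : Type*} [CommRing k] [IsDomain k] {n : ℕ} {a a' : Fin n → Fin n → k}

/-- Otherwise the image would be a scalar, hence so would the generator itself. -/
theorem degree_symbol_ne_zero (f : V a' ≃ₐ[k] V a) (m : MonomialOrder (Fin n)) (i : Fin n) :
    m.degree (symbol a (f (gen a' i))) ≠ 0 := by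
  intro h
  have h1 := m.eq_C_of_degree_eq_zero h
  rw [← symbol_algebraMap a] at h1
  have h3 := symbol_injective a h1
  rw [← AlgEquiv.commutes f] at h3
  have h4 := congrArg (symbol a') (f.injective h3)
  rw [symbol_gen, symbol_algebraMap] at h4
  have h5 := congrArg (coeff (single i 1)) h4
  rw [coeff_X, if_pos rfl, coeff_C, if_neg (Finsupp.single_ne_zero.2 one_ne_zero).symm] at h5
  exact one_ne_zero h5

theorem exists_degree_symbol_eq_single (h2 : (2 : k) ≠ 0) (hn : Even n) (f : V a' ≃ₐ[k] V a)
    (m : MonomialOrder (Fin n)) (j : Fin n) :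
    ∃ i, m.degree (symbol a (f (gen a' i))) = single j 1 := by
  set α : Fin n → Fin n →₀ ℕ := fun i => m.degree (symbol a (f (gen a' i))) with hα
  have hα0 : ∀ i, α i ≠ 0 := degree_symbol_ne_zero f m
  have hlead : ∀ i, IsLead m (symbol a (f (gen a' i))) (α i) _ := fun i => isLead_degree m _
  have hc : ∀ i, m.leadingCoeff (symbol a (f (gen a' i))) ≠ 0 := fun i => by
    rw [m.leadingCoeff_ne_zero_iff]
    exact m.ne_zero_of_degree_ne_zero (hα0 i)
  have hinj := sum_smul_injective hn (α := α) fun i l hil => by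
    refine odd_crossing_of_anticomm (r := entry a' i l) h2 a (hlead i) (hlead l) (hc i) (hc l)
      (hα0 i) ?_
    rw [← map_mul, ← map_mul, ← map_add, gen_anticomm_of_ne a' hil, AlgEquiv.commutes]
  have h3 : gen a j = orderedEval (fun i => f (gen a' i)) (symbol a' (f.symm (gen a j))) := by
    have := map_orderedEval (f : V a' →ₐ[k] V a) (gen a') (symbol a' (f.symm (gen a j)))
    rw [orderedEval_symbol] at this
    simpa using this
  have h4 : symbol a' (f.symm (gen a j)) ≠ 0 := fun h0 => by
    rw [h0, map_zero] at h3
    have := symbol_gen a j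
    rw [h3, map_zero] at this
    exact X_ne_zero j this.symm
  obtain ⟨d, s, hs, hd⟩ := exists_isLead_symbol_orderedEval a hlead hc hinj h4
  rw [← h3, symbol_gen] at hd
  have h5 : ∑ i, d i • α i = single j 1 :=
    hd.eq_of_ne_zero (isLead_monomial (single j 1) (1 : k)) hs one_ne_zero
  have h6 : ∃ i, d i ≠ 0 := by
    by_contra! hall
    simp only [hall, zero_smul, Finset.sum_const_zero] at h5
    exact Finsupp.single_ne_zero.2 one_ne_zero h5.symm
  obtain ⟨i, hi⟩ := h6
  refine ⟨i, ?_⟩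
  -- Exponents are natural numbers, so a summand with `d i ≠ 0` bounds `α i`; being nonzero, `α i`
  -- must then be all of `single j 1`.
  have h7 : α i ≤ single j 1 := by
    rw [← h5]
    refine le_trans ?_ (Finset.single_le_sum (f := fun i => d i • α i) (fun _ _ => zero_le)
      (Finset.mem_univ i))
    exact le_self_nsmul zero_le hi
  change α i = single j 1
  have h8 : ∀ l, α i l ≤ single j 1 l := h7
  have h9 : ∀ l, l ≠ j → α i l = 0 := fun l hl => by
    have := h8 l
    rw [Finsupp.single_eq_of_ne hl] at this
    omega
  have h10 : α i j ≠ 0 := fun h0 => hα0 i (by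
    ext l
    by_cases hl : l = j
    · rw [hl, h0]; rfl
    · rw [h9 l hl]; rfl)
  ext l
  by_cases hl : l = j
  · subst hl
    have := h8 l
    rw [Finsupp.single_eq_same] at this ⊢
    omega
  · rw [h9 l hl, Finsupp.single_eq_of_ne hl]

/-- Every isomorphism permutes the generators up to scalars. -/
theorem exists_perm_map_gen (h2 : (2 : k) ≠ 0) (hn : Even n) (f : V a' ≃ₐ[k] V a) :
    ∃ (σ : Equiv.Perm (Fin n)) (b : Fin n → k), ∀ i, f (gen a' i) = b i • gen a (σ i) := by
  -- The graded order matters: its leading exponent has the total degree of the polynomial, so the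
  -- images have degree one.
  choose τ hτ using exists_degree_symbol_eq_single h2 hn f MonomialOrder.degLex
  have hτinj : Function.Injective τ := fun i j h => by
    have := (hτ i).symm.trans (h ▸ hτ j)
    exact (Finsupp.single_left_inj one_ne_zero).1 this
  let e : Equiv.Perm (Fin n) := Equiv.ofBijective τ (Finite.injective_iff_bijective.1 hτinj)
  let σ := e.symm
  have hσ : ∀ i, MonomialOrder.degLex.degree (symbol a (f (gen a' i))) = single (σ i) 1 :=
    fun i => by
      conv_lhs => rw [← e.apply_symm_apply i]
      exact hτ (e.symm i)
  have haff : ∀ i, ∃ c b, f (gen a' i) = affine a c b := fun i => by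
    refine ⟨_, _, eq_affine a fun d hd => ?_⟩
    by_contra h0
    have h1 := le_totalDegree (MvPolynomial.mem_support_iff.2 h0)
    rw [← degree_degLexDegree, hσ i, Finsupp.degree_single] at h1
    exact absurd hd (not_lt.2 h1)
  choose c b hcb using haff
  have hb : ∀ i, b i (σ i) ≠ 0 := fun i => by
    rw [← coeff_single_symbol_affine a (c i) (b i) (σ i), ← hcb, ← hσ,
      MonomialOrder.coeff_degree_ne_zero_iff]
    exact MonomialOrder.degLex.ne_zero_of_degree_ne_zero (degree_symbol_ne_zero f _ i)
  have hanti : ∀ i l, i ≠ l → affine a (c i) (b i) * affine a (c l) (b l) +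
      affine a (c l) (b l) * affine a (c i) (b i) = algebraMap k _ (entry a' i l) := fun i l h => by
    rw [← hcb, ← hcb, ← map_mul, ← map_mul, ← map_add, gen_anticomm_of_ne a' h, AlgEquiv.commutes]
  have hb0 : ∀ i q, q ≠ σ i → b i q = 0 := fun i q hq => by
    obtain ⟨l, rfl⟩ := σ.surjective q
    have hil : i ≠ l := fun h => hq (by rw [h])
    exact (mul_eq_zero.1 (mul_eq_zero_of_affine_anticomm h2 (hanti i l hil) (σ l))).resolve_right
      (hb l)
  have hc0 : ∀ i, c i = 0 := fun i => by
    -- Killing the constant term needs a second generator; evenness provides it once an index `i`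
    -- exists.
    have hn1 : n ≠ 1 := fun h => by simp [h] at hn
    have : Nontrivial (Fin n) := Fin.nontrivial_iff_two_le.2 (by have := i.pos; omega)
    obtain ⟨l, hl⟩ := exists_ne i
    have h1 := add_eq_zero_of_affine_anticomm h2 (hanti i l hl.symm) (σ l)
    rw [hb0 i (σ l) (σ.injective.ne hl), mul_zero, add_zero] at h1
    exact (mul_eq_zero.1 h1).resolve_right (hb l)
  refine ⟨σ, fun i => b i (σ i), fun i => ?_⟩
  rw [hcb, affine, hc0, map_zero, zero_add, Finset.sum_eq_single (σ i)]
  · intro q _ hq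
    rw [hb0 i q hq, zero_smul]
  · simp

end Classification

/-! ### Invertibility of the scalars and the converse -/

section Scaling

variable {k : Type*} [CommRing k] {n : ℕ} {a a' : Fin n → Fin n → k}

theorem isUnit_of_map_gen (f : V a' ≃ₐ[k] V a) {σ : Equiv.Perm (Fin n)} {b : Fin n → k}
    (h : ∀ i, f (gen a' i) = b i • gen a (σ i)) (i : Fin n) : IsUnit (b i) := by
  -- Pulling back by the inverse writes the `i`-th generator as `b i` times an element; its own
  -- coefficient `1` is thus a multiple of `b i`.
  have h1 := congrArg (fun z => coeff (single i 1) (symbol a' (f.symm z))) (h i)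
  simp only [AlgEquiv.symm_apply_apply, symbol_gen, coeff_X, map_smul, coeff_smul,
    smul_eq_mul] at h1
  exact IsUnit.of_mul_eq_one _ h1.symm

/-- The homomorphism rescaling and permuting the generators. -/
theorem exists_algHom_of_entry_eq (σ : Equiv.Perm (Fin n)) (l : Fin n → k)
    (h : ∀ i j, i ≠ j → entry a' i j = l i * l j * entry a (σ i) (σ j)) :
    ∃ f : V a' →ₐ[k] V a, ∀ i, f (gen a' i) = l i • gen a (σ i) := by
  refine ⟨lift a' (fun i => l i • gen a (σ i)) fun i j hij => ?_, lift_gen _ _ _⟩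
  rw [show a' i j = entry a' i j from (if_pos hij).symm, h i j hij.ne, map_mul,
    ← gen_anticomm_of_ne a (σ.injective.ne hij.ne), smul_mul_smul_comm, smul_mul_smul_comm,
    mul_comm (l j), ← smul_add, Algebra.smul_def]

end Scaling

end QuantumWeyl

theorem theorem3 {k : Type*} [CommRing k] [IsDomain k] (hchar : ringChar k ≠ 2)
    (n : ℕ) (hn : Even n) (a a' : Fin n → Fin n → k) :
    Nonempty (QuantumWeyl.V a ≃ₐ[k] QuantumWeyl.V a') ↔
      ∃ (σ : Equiv.Perm (Fin n)) (l : Fin n → kˣ), ∀ i j : Fin n, i ≠ j →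
        QuantumWeyl.entry a' i j =
          (l i : k) * (l j : k) * QuantumWeyl.entry a (σ i) (σ j) := by
  open QuantumWeyl in
  constructor
  · rintro ⟨g⟩
    -- The inverse is used so that the relations of `a'` are expressed through the entries of `a`,
    -- as the formula requires.
    obtain ⟨σ, b, h⟩ := exists_perm_map_gen (Ring.two_ne_zero hchar) hn g.symm
    refine ⟨σ, fun i => (isUnit_of_map_gen g.symm h i).unit, fun i j hij => ?_⟩
    have h1 := congrArg g.symm (gen_anticomm_of_ne a' hij)
    rw [map_add, map_mul, map_mul, h, h, smul_mul_smul_comm, smul_mul_smul_comm, mul_comm (b j),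
      ← smul_add, gen_anticomm_of_ne a (σ.injective.ne hij), AlgEquiv.commutes,
      Algebra.smul_def, ← map_mul] at h1
    have h3 := congrArg (symbol a) h1
    rw [symbol_algebraMap, symbol_algebraMap] at h3
    exact (MvPolynomial.C_injective _ _ h3).symm
  · rintro ⟨σ, l, h⟩
    obtain ⟨f, hf⟩ := exists_algHom_of_entry_eq σ (fun i => (l i : k)) h
    obtain ⟨g, hg⟩ := exists_algHom_of_entry_eq (a := a') (a' := a) σ.symm
      (fun i => ((l (σ.symm i))⁻¹ : kˣ)) fun i j hij => by
        rw [h _ _ (σ.symm.injective.ne hij), σ.apply_symm_apply, σ.apply_symm_apply]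
        linear_combination (-(entry a i j) * ((l (σ.symm i))⁻¹ : kˣ) * l (σ.symm i)) *
          (l (σ.symm j)).inv_mul
          - entry a i j * (l (σ.symm i)).inv_mul
    refine ⟨AlgEquiv.ofAlgHom g f (algHom_ext _ fun i => ?_) (algHom_ext _ fun i => ?_)⟩
    · simp [hf, hg, smul_smul]
    · simp [hf, hg, smul_smul]
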